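/- Let $\mathbb K$ be $\mathbb R$ or $\mathbb C$. For a compact set $\Omega\subset\mathbb R^d$ let $C(\Omega)$ be the space of continuous functions $\Omega\to\mathbb K$ with the uniform norm $\|\cdot\|_\infty$. For $F\subset C(\Omega)$ and $n\ge 1$ let $$d_n(F,L_\infty):=\inf_{u_1,\dots,u_n\in C(\Omega)}\ \sup_{f\in F}\ \inf_{c_1,\dots,c_n\in\mathbb K}\Big\|f-\sum_{i=1}^n c_iu_i\Big\|_\infty$$ be the Kolmogorov width of $F$ in the uniform norm. For a Borel probability measure $\mu$ on $\Omega$, $1\le p<\infty$ and $m\ge1$ let $$\varrho^*_m(F,L_p(\Omega,\mu)):=\inf_{\xi,X,\Phi}\ \sup_{f\in F}\ \big\|f-\Phi(f(\xi^1),\dots,f(\xi^m))\big\|_{L_p(\Omega,\mu)},$$ where the infimum is over all points $\xi^1,\dots,\xi^m\in\Omega$, all linear subspaces $X\subset L_p(\Omega,\mu)$ of dimension at most $m$, and all (not necessarily linear) mappings $\Phi:\mathbb K^m\to X$. Then there exist absolute constants $b\in\mathbb N$, $b\ge1$, and $B>0$ such that for every $s\in\mathbb N$, $s\ge 1$, with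 $p=2s$, every $d$, every compact set $\Omega\subset\mathbb R^d$, every Borel probability measure $\mu$ on $\Omega$, every compact set $F\subset C(\Omega)$ (real- or complex-valued), and every integer $n\ge1$, $$\varrho^*_{b n^{p/2}}(F,L_p(\Omega,\mu))\le B\,d_n(F,L_\infty).$$ -/

import Mathlib

open MeasureTheory
open scoped ENNReal NNReal

noncomputable section

/-- The Kolmogorov width `d_n(F, E)` of a set `F` in a normed space `E`, with values in `[0, ∞]`:
the infimum over all systems `u_1, …, u_n` in `E` of the supremum over `f ∈ F` of the distance
from `f` to the span of the system. -/
def kolmogorovWidth (𝕜 : Type*) {E : Type*} [RCLike 𝕜] [NormedAddCommGroup E] [NormedSpace 𝕜 E]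
    (n : ℕ) (F : Set E) : ℝ≥0∞ :=
  ⨅ u : Fin n → E, ⨆ f ∈ F, ⨅ c : Fin n → 𝕜, ‖f - ∑ i, c i • u i‖ₑ

/-- The optimal (nonlinear) sampling recovery error `ϱ*_m(F, L_p(Ω, μ))` of a class `F` of
continuous functions, with values in `[0, ∞]`: the infimum over all points `ξ_1, …, ξ_m` of `Ω`,
all linear subspaces `X` of `L_p(Ω, μ)` of dimension at most `m` and all mappings `Φ` (linear or
not) from `𝕜^m` to `X`, of the supremum over `f ∈ F` of `‖f - Φ(f(ξ_1), …, f(ξ_m))‖_p`. -/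
def samplingRecovery {𝕜 Ω : Type*} [RCLike 𝕜] [TopologicalSpace Ω] [MeasurableSpace Ω]
    (m : ℕ) (F : Set C(Ω, 𝕜)) (p : ℝ≥0∞) (μ : Measure Ω) : ℝ≥0∞ :=
  ⨅ (ξ : Fin m → Ω) (X : Submodule 𝕜 (Lp 𝕜 p μ))
    (_ : FiniteDimensional 𝕜 X ∧ Module.finrank 𝕜 X ≤ m) (Φ : (Fin m → 𝕜) → X),
    ⨆ f ∈ F, eLpNorm (fun x => f x - (Φ (fun j => f (ξ j)) : Lp 𝕜 p μ) x) p μ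

end

/-! Fix `u` nearly optimal for the width. The `s`-th power of any function in the span of the `u i`
lies in the span of the `N = n ^ s` products of `s` of them, and its `L²` norm is the `s`-th power
of an `L_{2s}` norm. So `L_{2s}` discretization reduces to `L²` discretization on a space of
dimension at most `N`. There, unweighted lower-barrier selection (Batson–Spielman–Srivastava) gives
`6 * N` points whose Gram matrix dominates `N` times the identity, whence `‖g‖₂² ≤ 6 max |g(ξ j)|²`
(`exists_points_sum_norm_sq_le`). Recovery picks any element of the span fitting the samples within
`τ`: it is `2τ`-close at the points to a uniform `τ`-approximant of `f`, so the error is at most `τ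
+ 3 * 2τ = 7τ`. -/

/-! ### Matrix potential for the lower barrier -/

open scoped Matrix ComplexOrder in
/-- In the spectral decomposition of a Hermitian matrix `M`, every matrix `M - c` with `c` smaller
than all eigenvalues is positive definite, with explicit traces of the first two powers of its
inverse. -/
theorem posDef_sub_smul_one_and_trace_inv {𝕜 ι : Type*} [RCLike 𝕜] [Fintype ι] [DecidableEq ι]
    {M : Matrix ι ι 𝕜} (hM : M.IsHermitian) (c : ℝ) (hc : ∀ i, c < hM.eigenvalues i) :
    (M - (c : 𝕜) • 1).PosDef ∧
      RCLike.re (M - (c : 𝕜) • 1)⁻¹.trace = ∑ i, (hM.eigenvalues i - c)⁻¹ ∧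
      RCLike.re ((M - (c : 𝕜) • 1)⁻¹ * (M - (c : 𝕜) • 1)⁻¹).trace =
        ∑ i, ((hM.eigenvalues i - c)⁻¹) ^ 2 := by
  set U := hM.eigenvectorUnitary
  have h1 : (U : Matrix ι ι 𝕜) * star (U : Matrix ι ι 𝕜) = 1 := Unitary.mul_star_self_of_mem U.2
  have h2 : star (U : Matrix ι ι 𝕜) * (U : Matrix ι ι 𝕜) = 1 := Unitary.star_mul_self_of_mem U.2
  have hspec : M - (c : 𝕜) • 1 = (U : Matrix ι ι 𝕜) *
      Matrix.diagonal (fun i => ((hM.eigenvalues i - c : ℝ) : 𝕜)) * star (U : Matrix ι ι 𝕜) := by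
    have hd : Matrix.diagonal (fun i => ((hM.eigenvalues i - c : ℝ) : 𝕜)) =
        Matrix.diagonal (RCLike.ofReal ∘ hM.eigenvalues) - (c : 𝕜) • (1 : Matrix ι ι 𝕜) := by
      rw [Matrix.smul_one_eq_diagonal, Matrix.diagonal_sub]
      simp
    have := hM.spectral_theorem
    rw [Unitary.conjStarAlgAut_apply] at this
    rw [hd, mul_sub, sub_mul, ← this, mul_smul_comm, smul_mul_assoc, mul_one, h1]
  have hinv : (M - (c : 𝕜) • 1)⁻¹ = (U : Matrix ι ι 𝕜) *
      Matrix.diagonal (fun i => (((hM.eigenvalues i - c)⁻¹ : ℝ) : 𝕜)) *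
        star (U : Matrix ι ι 𝕜) := by
    apply Matrix.inv_eq_right_inv
    rw [hspec]
    calc _ = (U : Matrix ι ι 𝕜) * (Matrix.diagonal (fun i => ((hM.eigenvalues i - c : ℝ) : 𝕜)) *
          (star (U : Matrix ι ι 𝕜) * (U : Matrix ι ι 𝕜)) *
          Matrix.diagonal (fun i => (((hM.eigenvalues i - c)⁻¹ : ℝ) : 𝕜))) *
            star (U : Matrix ι ι 𝕜) := by simp only [mul_assoc]
      _ = 1 := by
        rw [h2, mul_one, Matrix.diagonal_mul_diagonal]
        have : (fun i => ((hM.eigenvalues i - c : ℝ) : 𝕜) *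
            (((hM.eigenvalues i - c)⁻¹ : ℝ) : 𝕜)) = fun _ => 1 := by
          funext i
          rw [← RCLike.ofReal_mul, mul_inv_cancel₀ (sub_pos.2 (hc i)).ne', RCLike.ofReal_one]
        rw [this, Matrix.diagonal_one, mul_one, h1]
  have htr : ∀ d : ι → ℝ, RCLike.re ((U : Matrix ι ι 𝕜) *
      Matrix.diagonal (fun i => ((d i : ℝ) : 𝕜)) * star (U : Matrix ι ι 𝕜)).trace = ∑ i, d i := by
    intro d
    rw [Matrix.trace_mul_cycle, h2, one_mul, Matrix.trace_diagonal, map_sum]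
    simp
  refine ⟨?_, ?_, ?_⟩
  · rw [hspec, Matrix.IsUnit.posDef_star_right_conjugate_iff
      (IsUnit.of_mul_eq_one _ h1), Matrix.posDef_diagonal_iff]
    intro i
    exact_mod_cast sub_pos.2 (hc i)
  · rw [hinv, htr]
  · rw [hinv]
    rw [← htr]
    congr 2
    calc _ = (U : Matrix ι ι 𝕜) * (Matrix.diagonal (fun i => (((hM.eigenvalues i - c)⁻¹ : ℝ) : 𝕜)) *
          (star (U : Matrix ι ι 𝕜) * (U : Matrix ι ι 𝕜)) *
          Matrix.diagonal (fun i => (((hM.eigenvalues i - c)⁻¹ : ℝ) : 𝕜))) *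
            star (U : Matrix ι ι 𝕜) := by simp only [mul_assoc]
      _ = _ := by
        rw [h2, mul_one, Matrix.diagonal_mul_diagonal]
        simp only [pow_two, RCLike.ofReal_mul]

open scoped Matrix ComplexOrder in
/-- Shifting the lower barrier of a positive definite matrix with trace of the inverse at most one
keeps it positive definite, and the trace of the inverse grows in a controlled way. -/
theorem posDef_sub_third_and_trace_le {𝕜 ι : Type*} [RCLike 𝕜] [Fintype ι] [DecidableEq ι]
    {M P : Matrix ι ι 𝕜} (hM : M.PosDef) (htr : RCLike.re M⁻¹.trace ≤ 1)
    (hP : P = M - ((1 / 3 : ℝ) : 𝕜) • 1) :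
    P.PosDef ∧ (1 + RCLike.re P⁻¹.trace) * (RCLike.re P⁻¹.trace - RCLike.re M⁻¹.trace) ≤
      RCLike.re (P⁻¹ * P⁻¹).trace := by
  have hpos := hM.eigenvalues_pos
  obtain ⟨-, h0, -⟩ := posDef_sub_smul_one_and_trace_inv hM.1 0 hpos
  simp only [RCLike.ofReal_zero, zero_smul, sub_zero] at h0
  rw [h0] at htr
  -- Each inverse eigenvalue is one term of a positive sum bounded by 1, so a shift by 1/3 is safe.
  have hone : ∀ i, 1 ≤ hM.1.eigenvalues i := by
    intro i
    have := (Finset.single_le_sum (f := fun i => (hM.1.eigenvalues i)⁻¹)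
      (fun j _ => (inv_pos.2 (hpos j)).le) (Finset.mem_univ i)).trans htr
    exact (inv_le_one₀ (hpos i)).1 this
  obtain ⟨hPD, h1, h2⟩ := posDef_sub_smul_one_and_trace_inv hM.1 (1 / 3 : ℝ)
    (fun i => by linarith [hone i])
  rw [← hP] at hPD h1 h2
  refine ⟨hPD, ?_⟩
  rw [h0, h1, h2]
  set l := hM.1.eigenvalues
  have hQ : ∑ i, (l i - 1 / 3)⁻¹ ≤ 3 / 2 := by
    calc _ ≤ ∑ i, 3 / 2 * (l i)⁻¹ := by
          refine Finset.sum_le_sum fun i _ => ?_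
          have := hone i
          rw [inv_le_comm₀ (by linarith) (by have := hpos i; positivity), mul_inv, inv_inv]
          linarith
      _ ≤ 3 / 2 := by rw [← Finset.mul_sum]; linarith
  have hdiff : ∑ i, (l i - 1 / 3)⁻¹ - ∑ i, (l i)⁻¹ ≤ 1 / 3 * ∑ i, ((l i - 1 / 3)⁻¹) ^ 2 := by
    rw [← Finset.sum_sub_distrib, Finset.mul_sum]
    refine Finset.sum_le_sum fun i _ => ?_
    have h := hone i
    have e1 : (l i - 1 / 3)⁻¹ - (l i)⁻¹ = 1 / 3 * ((l i - 1 / 3)⁻¹ * (l i)⁻¹) := by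
      have : l i - 1 / 3 ≠ 0 := by linarith
      have : l i ≠ 0 := by linarith
      rw [inv_sub_inv ‹_› ‹_›, div_eq_mul_inv, mul_inv]
      ring
    rw [e1, pow_two]
    have e2 : (l i)⁻¹ ≤ (l i - 1 / 3)⁻¹ := inv_anti₀ (by linarith) (by linarith)
    have e3 : 0 ≤ (l i - 1 / 3)⁻¹ := inv_nonneg.2 (by linarith)
    gcongr
  have hQ0 : 0 ≤ ∑ i, (l i - 1 / 3)⁻¹ :=
    Finset.sum_nonneg fun i _ => inv_nonneg.2 (by linarith [hone i])
  have hS : 0 ≤ ∑ i, ((l i - 1 / 3)⁻¹) ^ 2 := Finset.sum_nonneg fun i _ => sq_nonneg _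
  -- The shift 1/3 is small enough: (1 + 3/2) * (1/3) = 5/6 < 1.
  nlinarith

open scoped Matrix ComplexOrder in
/-- The trace of the inverse of a rank-one perturbation of a positive definite matrix. -/
theorem re_trace_inv_add_vecMulVec {𝕜 ι : Type*} [RCLike 𝕜] [Fintype ι] [DecidableEq ι]
    {P : Matrix ι ι 𝕜} (hP : P.PosDef) (v : ι → 𝕜) :
    0 ≤ RCLike.re (star v ⬝ᵥ (P⁻¹ *ᵥ v)) ∧
    RCLike.re (P + Matrix.vecMulVec v (star v))⁻¹.trace = RCLike.re P⁻¹.trace -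
      RCLike.re (star v ⬝ᵥ ((P⁻¹ * P⁻¹) *ᵥ v)) / (1 + RCLike.re (star v ⬝ᵥ (P⁻¹ *ᵥ v))) := by
  have hα := hP.inv.posSemidef.dotProduct_mulVec_nonneg v
  set α := star v ⬝ᵥ (P⁻¹ *ᵥ v) with hαd
  obtain ⟨hre, him⟩ := RCLike.nonneg_iff.1 hα
  have hαr : α = ((RCLike.re α : ℝ) : 𝕜) := (RCLike.conj_eq_iff_re.1 (RCLike.conj_eq_iff_im.2 him)).symm
  have hne : (1 + α) ≠ 0 := by
    rw [hαr]; exact_mod_cast (by positivity : (1 + RCLike.re α : ℝ) ≠ 0)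
  have hdet : IsUnit P.det := (Matrix.isUnit_iff_isUnit_det _).1 hP.isUnit
  -- Sherman–Morrison formula.
  have hinv : (P + Matrix.vecMulVec v (star v))⁻¹ =
      P⁻¹ - (1 + α)⁻¹ • Matrix.vecMulVec (P⁻¹ *ᵥ v) (star v ᵥ* P⁻¹) := by
    apply Matrix.inv_eq_right_inv
    rw [add_mul, mul_sub, mul_sub, Matrix.mul_nonsing_inv _ hdet, mul_smul_comm, mul_smul_comm,
      Matrix.mul_vecMulVec, Matrix.mulVec_mulVec, Matrix.mul_nonsing_inv _ hdet,
      Matrix.one_mulVec, Matrix.vecMulVec_mul, Matrix.vecMulVec_mul_vecMulVec, ← hαd,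
      Matrix.vecMulVec_smul]
    rw [smul_smul]
    have : (1 + α)⁻¹ * α = 1 - (1 + α)⁻¹ := by field_simp; ring
    rw [this, sub_smul, one_smul]
    abel
  refine ⟨hre, ?_⟩
  rw [hinv, Matrix.trace_sub, Matrix.trace_smul, Matrix.trace_vecMulVec, map_sub]
  congr 1
  rw [dotProduct_comm, Matrix.dotProduct_mulVec, Matrix.vecMul_vecMul,
    ← Matrix.dotProduct_mulVec, smul_eq_mul, div_eq_inv_mul]
  have : (1 + α)⁻¹ = (((1 + RCLike.re α)⁻¹ : ℝ) : 𝕜) := by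
    rw [hαr]; simp
  rw [this, RCLike.re_ofReal_mul]

/-! ### Selection of points by averaging -/

open scoped Matrix in
/-- The mean of a Hermitian form along an orthonormal family in `L²` is its trace. -/
theorem integral_re_star_dotProduct_mulVec {𝕜 Ω ι : Type*} [RCLike 𝕜] [MeasurableSpace Ω]
    {μ : Measure Ω} [Fintype ι] [DecidableEq ι] {e : ι → Lp 𝕜 2 μ} (he : Orthonormal 𝕜 e)
    (Q : Matrix ι ι 𝕜) :
    Integrable (fun x => RCLike.re (star (fun i => e i x) ⬝ᵥ (Q *ᵥ fun i => e i x))) μ ∧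
      ∫ x, RCLike.re (star (fun i => e i x) ⬝ᵥ (Q *ᵥ fun i => e i x)) ∂μ =
        RCLike.re Q.trace := by
  have hexp : ∀ x, star (fun i => e i x) ⬝ᵥ (Q *ᵥ fun i => e i x) =
      ∑ i, ∑ j, Q i j * inner 𝕜 (e i x) (e j x) := by
    intro x
    simp only [dotProduct, Matrix.mulVec, Pi.star_apply, Finset.mul_sum, RCLike.inner_apply,
      RCLike.star_def]
    refine Finset.sum_congr rfl fun i _ => Finset.sum_congr rfl fun j _ => by ring
  have hint : ∀ i j, Integrable (fun x => Q i j * inner 𝕜 (e i x) (e j x)) μ :=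
    fun i j => (L2.integrable_inner (e i) (e j)).const_mul _
  have hint' : Integrable (fun x => star (fun i => e i x) ⬝ᵥ (Q *ᵥ fun i => e i x)) μ := by
    simp only [hexp]
    exact integrable_finsetSum _ fun i _ => integrable_finsetSum _ fun j _ => hint i j
  refine ⟨hint'.re, ?_⟩
  rw [integral_re hint']
  congr 1
  simp only [hexp]
  rw [integral_finsetSum _ fun i _ => integrable_finsetSum _ fun j _ => hint i j, Matrix.trace]
  refine Finset.sum_congr rfl fun i _ => ?_
  rw [integral_finsetSum _ fun j _ => hint i j]
  have : ∀ j, ∫ x, Q i j * inner 𝕜 (e i x) (e j x) ∂μ = Q i j * if i = j then 1 else 0 := by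
    intro j
    rw [integral_const_mul, ← orthonormal_iff_ite.1 he i j, L2.inner_def]
  simp only [this, mul_ite, mul_one, mul_zero, Finset.sum_ite_eq, Finset.mem_univ, if_true,
    Matrix.diag_apply]

open scoped Matrix ComplexOrder in
/-- One step of the lower barrier argument of Batson, Spielman and Srivastava, with unit weights. -/
theorem exists_notMem_null_posDef_sub_add_vecMulVec {𝕜 Ω ι : Type*} [RCLike 𝕜]
    [MeasurableSpace Ω] {μ : Measure Ω} [IsProbabilityMeasure μ] [Fintype ι] [DecidableEq ι]
    {e : ι → Lp 𝕜 2 μ} (he : Orthonormal 𝕜 e) {Z : Set Ω} (hZ : μ Z = 0) {M : Matrix ι ι 𝕜}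
    (hM : M.PosDef) (htr : RCLike.re M⁻¹.trace ≤ 1) :
    ∃ x, x ∉ Z ∧
      (M - ((1 / 3 : ℝ) : 𝕜) • 1 +
        Matrix.vecMulVec (fun i => e i x) (star fun i => e i x)).PosDef ∧
      RCLike.re (M - ((1 / 3 : ℝ) : 𝕜) • 1 +
        Matrix.vecMulVec (fun i => e i x) (star fun i => e i x))⁻¹.trace ≤ 1 := by
  obtain ⟨hP, hineq⟩ := posDef_sub_third_and_trace_le hM htr rfl
  set P := M - ((1 / 3 : ℝ) : 𝕜) • 1
  set D := RCLike.re P⁻¹.trace - RCLike.re M⁻¹.trace with hD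
  obtain ⟨i1, t1⟩ := integral_re_star_dotProduct_mulVec he P⁻¹
  obtain ⟨i2, t2⟩ := integral_re_star_dotProduct_mulVec he (P⁻¹ * P⁻¹)
  have i3 : Integrable (fun x => 1 + RCLike.re (star (fun i => e i x) ⬝ᵥ
      (P⁻¹ *ᵥ fun i => e i x))) μ := (integrable_const (1 : ℝ)).add i1
  -- By `hineq` the mean of this function is nonnegative, so at some point the rank-one gain offsets
  -- the loss `D` from the shift.
  obtain ⟨x, hxZ, hx⟩ := exists_notMem_null_integral_le (i2.sub (i3.mul_const D)) hZ
  refine ⟨x, hxZ, hP.add_posSemidef (Matrix.posSemidef_vecMulVec_self_star _), ?_⟩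
  simp only [Pi.sub_apply] at hx
  rw [integral_sub i2 (i3.mul_const D), integral_mul_const,
    integral_add (integrable_const _) i1, t1, t2] at hx
  simp only [integral_const, probReal_univ, smul_eq_mul, one_mul] at hx
  obtain ⟨hq, hsm⟩ := re_trace_inv_add_vecMulVec hP (fun i => e i x)
  rw [hsm]
  have : D ≤ RCLike.re (star (fun i => e i x) ⬝ᵥ ((P⁻¹ * P⁻¹) *ᵥ fun i => e i x)) /
      (1 + RCLike.re (star (fun i => e i x) ⬝ᵥ (P⁻¹ *ᵥ fun i => e i x))) := by
    rw [le_div_iff₀ (by positivity)]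
    linarith
  linarith

-- The barrier starts at `-N`, where the trace of the inverse is `card ι / N ≤ 1`, and rises by 1/3
-- with each new point; the trace bound is the invariant that lets the induction continue.
open scoped Matrix ComplexOrder in
theorem exists_points_posDef {𝕜 Ω ι : Type*} [RCLike 𝕜] [MeasurableSpace Ω] {μ : Measure Ω}
    [IsProbabilityMeasure μ] [Fintype ι] [DecidableEq ι] {e : ι → Lp 𝕜 2 μ}
    (he : Orthonormal 𝕜 e) {Z : Set Ω} (hZ : μ Z = 0) {N : ℕ} (hN : 0 < N)
    (hcard : Fintype.card ι ≤ N) (K : ℕ) :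
    ∃ ξ : Fin K → Ω, (∀ j, ξ j ∉ Z) ∧
      (((N - K / 3 : ℝ) : 𝕜) • (1 : Matrix ι ι 𝕜) +
        ∑ j, Matrix.vecMulVec (fun i => e i (ξ j)) (star fun i => e i (ξ j))).PosDef ∧
      RCLike.re (((N - K / 3 : ℝ) : 𝕜) • (1 : Matrix ι ι 𝕜) +
        ∑ j, Matrix.vecMulVec (fun i => e i (ξ j)) (star fun i => e i (ξ j)))⁻¹.trace ≤ 1 := by
  induction K with
  | zero =>
    refine ⟨Fin.elim0, fun j => j.elim0, ?_⟩
    have h0 : (0 : ℝ) < N := Nat.cast_pos.2 hN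
    have hinv : (((N : ℝ) : 𝕜) • (1 : Matrix ι ι 𝕜))⁻¹ = (((N : ℝ)⁻¹ : ℝ) : 𝕜) • 1 := by
      apply Matrix.inv_eq_right_inv
      rw [smul_mul_smul_comm, one_mul, ← RCLike.ofReal_mul, mul_inv_cancel₀ h0.ne',
        RCLike.ofReal_one, one_smul]
    simp only [Nat.cast_zero, zero_div, sub_zero, Finset.univ_eq_empty, Finset.sum_empty, add_zero]
    refine ⟨Matrix.PosDef.one.smul (by exact_mod_cast h0), ?_⟩
    rw [hinv, Matrix.trace_smul, Matrix.trace_one, smul_eq_mul, RCLike.re_ofReal_mul,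
      RCLike.natCast_re, ← div_eq_inv_mul, div_le_one h0]
    exact_mod_cast hcard
  | succ K ih =>
    obtain ⟨ξ, hξZ, hPD, htr⟩ := ih
    obtain ⟨x, hxZ, hPD', htr'⟩ := exists_notMem_null_posDef_sub_add_vecMulVec he hZ hPD htr
    refine ⟨Fin.snoc ξ x, ?_, ?_⟩
    · intro j
      refine Fin.lastCases ?_ (fun j => ?_) j
      · simpa using hxZ
      · simpa using hξZ j
    · have : ((N - (K + 1 : ℕ) / 3 : ℝ) : 𝕜) • (1 : Matrix ι ι 𝕜) +
          ∑ j, Matrix.vecMulVec (fun i => e i ((Fin.snoc ξ x : Fin (K + 1) → Ω) j))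
            (star fun i => e i ((Fin.snoc ξ x : Fin (K + 1) → Ω) j)) =
          ((N - K / 3 : ℝ) : 𝕜) • (1 : Matrix ι ι 𝕜) +
        ∑ j, Matrix.vecMulVec (fun i => e i (ξ j)) (star fun i => e i (ξ j)) -
          ((1 / 3 : ℝ) : 𝕜) • 1 + Matrix.vecMulVec (fun i => e i x) (star fun i => e i x) := by
        rw [Fin.sum_univ_castSucc]
        simp only [Fin.snoc_castSucc, Fin.snoc_last]
        have : ((N - (K + 1 : ℕ) / 3 : ℝ) : 𝕜) =
            ((N - K / 3 : ℝ) : 𝕜) - ((1 / 3 : ℝ) : 𝕜) := by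
          push_cast
          ring
        rw [this, sub_smul]
        abel
      rw [this]
      exact ⟨hPD', htr'⟩

open scoped Matrix ComplexOrder in
/-- A one-sided unweighted discretization inequality for orthonormal families in `L²`. -/
theorem exists_points_sum_norm_sq_le {𝕜 Ω ι : Type*} [RCLike 𝕜] [MeasurableSpace Ω]
    {μ : Measure Ω} [IsProbabilityMeasure μ] [Fintype ι] {e : ι → Lp 𝕜 2 μ}
    (he : Orthonormal 𝕜 e) {Z : Set Ω} (hZ : μ Z = 0) {N : ℕ} (hN : 0 < N)
    (hcard : Fintype.card ι ≤ N) :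
    ∃ ξ : Fin (6 * N) → Ω, (∀ j, ξ j ∉ Z) ∧
      ∀ c : ι → 𝕜, N * ∑ i, ‖c i‖ ^ 2 ≤ ∑ j, ‖∑ i, c i * e i (ξ j)‖ ^ 2 := by
  classical
  obtain ⟨ξ, hξZ, hPD, -⟩ := exists_points_posDef he hZ hN hcard (6 * N)
  refine ⟨ξ, hξZ, fun c => ?_⟩
  have h := hPD.posSemidef.dotProduct_mulVec_nonneg (star c)
  -- After `6 * N` steps the barrier has moved from `-N` to `N`.
  have e1 : ((N - (6 * N : ℕ) / 3 : ℝ) : 𝕜) = ((-N : ℝ) : 𝕜) := by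
    congr 1; push_cast; ring
  have e2 : star (star c) ⬝ᵥ star c = ((∑ i, ‖c i‖ ^ 2 : ℝ) : 𝕜) := by
    rw [star_star]
    simp only [dotProduct, Pi.star_apply, RCLike.star_def, RCLike.mul_conj]
    push_cast
    rfl
  have e3 : ∀ v : ι → 𝕜, star (star c) ⬝ᵥ (Matrix.vecMulVec v (star v) *ᵥ star c) =
      ((‖∑ i, c i * v i‖ ^ 2 : ℝ) : 𝕜) := by
    intro v
    rw [Matrix.vecMulVec_mulVec, star_star, dotProduct_smul, Matrix.star_dotProduct_star,
      op_smul_eq_mul, RCLike.star_def, RCLike.mul_conj]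
    push_cast
    rfl
  rw [e1, Matrix.add_mulVec, Matrix.sum_mulVec, dotProduct_add, dotProduct_sum,
    Matrix.smul_mulVec, Matrix.one_mulVec, dotProduct_smul, e2] at h
  simp only [e3, smul_eq_mul] at h
  have h' : (0 : ℝ) ≤ -N * (∑ i, ‖c i‖ ^ 2) + ∑ j, ‖∑ i, c i * e i (ξ j)‖ ^ 2 := by
    exact_mod_cast h
  linarith

/-! ### Discretization of `L²` and `L_{2s}` norms -/

/-- Every space spanned by at most `N` functions of `L²` admits `6 N` points at which the maximum
of the modulus controls the `L²` norm, up to an absolute constant. -/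
theorem exists_points_eLpNorm_two_le {𝕜 Ω κ : Type*} [RCLike 𝕜] [MeasurableSpace Ω]
    {μ : Measure Ω} [IsProbabilityMeasure μ] [Fintype κ] {g : κ → Ω → 𝕜}
    (hg : ∀ k, MemLp (g k) 2 μ) {N : ℕ} (hN : 0 < N) (hcard : Fintype.card κ ≤ N) :
    ∃ ξ : Fin (6 * N) → Ω, ∀ (a : κ → 𝕜) (t : ℝ), 0 ≤ t →
      (∀ j, ‖∑ k, a k * g k (ξ j)‖ ≤ t) →
        eLpNorm (fun x => ∑ k, a k * g k x) 2 μ ≤ ENNReal.ofReal (3 * t) := by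
  set G : κ → Lp 𝕜 2 μ := fun k => (hg k).toLp
  set Y : Submodule 𝕜 (Lp 𝕜 2 μ) := Submodule.span 𝕜 (Set.range G)
  have : FiniteDimensional 𝕜 Y := FiniteDimensional.span_of_finite 𝕜 (Set.finite_range G)
  set b := stdOrthonormalBasis 𝕜 Y
  set GY : κ → Y := fun k => ⟨G k, Submodule.subset_span ⟨k, rfl⟩⟩
  have he : Orthonormal 𝕜 (fun i => (b i : Lp 𝕜 2 μ)) :=
    b.orthonormal.comp_linearIsometry Y.subtypeₗᵢ
  -- Basis elements are classes, so their values represent `g k` only off a null set, which the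
  -- points must avoid.
  have hae : ∀ᵐ x ∂μ, ∀ k, g k x = ∑ i, inner 𝕜 (b i) (GY k) * (b i : Lp 𝕜 2 μ) x := by
    rw [ae_all_iff]
    intro k
    have h1 : G k = ∑ i, inner 𝕜 (b i) (GY k) • (b i : Lp 𝕜 2 μ) := by
      have := congrArg (Submodule.subtype Y) (b.sum_repr' (GY k))
      simpa [map_sum] using this.symm
    have h2 := (hg k).coeFn_toLp
    have h3 : ∀ᵐ x ∂μ, ∀ i, (inner 𝕜 (b i) (GY k) • (b i : Lp 𝕜 2 μ) : Lp 𝕜 2 μ) x =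
        inner 𝕜 (b i) (GY k) * (b i : Lp 𝕜 2 μ) x := by
      rw [ae_all_iff]
      exact fun i => Lp.coeFn_smul _ _
    have h4 := Lp.coeFn_finsetSum Finset.univ
      (fun i => inner 𝕜 (b i) (GY k) • (b i : Lp 𝕜 2 μ))
    filter_upwards [h2, h3, h4] with x h2 h3 h4
    rw [← h2]
    change G k x = _
    rw [h1, h4, Finset.sum_apply]
    exact Finset.sum_congr rfl fun i _ => h3 i
  have hfr : Fintype.card (Fin (Module.finrank 𝕜 Y)) ≤ N := by
    rw [Fintype.card_fin]
    exact (finrank_range_le_card G).trans hcard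
  obtain ⟨ξ, hξ, hdisc⟩ := exists_points_sum_norm_sq_le he (ae_iff.1 hae) hN hfr
  refine ⟨ξ, fun a t ht hle => ?_⟩
  have hξ' : ∀ j k, g k (ξ j) = ∑ i, inner 𝕜 (b i) (GY k) * (b i : Lp 𝕜 2 μ) (ξ j) :=
    fun j => not_not.1 (hξ j)
  set y : Y := ∑ k, a k • GY k with hy
  have hval : ∀ j, ∑ i, inner 𝕜 (b i) y * (b i : Lp 𝕜 2 μ) (ξ j) = ∑ k, a k * g k (ξ j) := by
    intro j
    simp only [hξ', hy, inner_sum, Finset.sum_mul, Finset.mul_sum]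
    rw [Finset.sum_comm]
    exact Finset.sum_congr rfl fun k _ => Finset.sum_congr rfl fun i _ => by
      rw [inner_smul_right (b i) (GY k) (a k)]
      ring
  have hmain := hdisc (fun i => inner 𝕜 (b i) y)
  rw [b.sum_sq_norm_inner_right] at hmain
  have hub : ∑ j, ‖∑ i, inner 𝕜 (b i) y * (b i : Lp 𝕜 2 μ) (ξ j)‖ ^ 2 ≤ (6 * N : ℕ) * t ^ 2 := by
    calc _ ≤ ∑ j : Fin (6 * N), t ^ 2 := by
          refine Finset.sum_le_sum fun j _ => ?_
          rw [hval]
          exact pow_le_pow_left₀ (norm_nonneg _) (hle j) 2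
      _ = _ := by simp
  have hN' : (0 : ℝ) < N := Nat.cast_pos.2 hN
  have hnorm : ‖y‖ ^ 2 ≤ 6 * t ^ 2 := by
    refine le_of_mul_le_mul_left ?_ hN'
    calc _ ≤ _ := hmain.trans hub
      _ = _ := by push_cast; ring
  have hnorm' : ‖(y : Lp 𝕜 2 μ)‖ ≤ 3 * t :=
    abs_le_of_sq_le_sq' (by change ‖y‖ ^ 2 ≤ _; nlinarith) (by positivity) |>.2
  have hcoe : (fun x => ∑ k, a k * g k x) =ᵐ[μ] (y : Lp 𝕜 2 μ) := by
    have h1 : (y : Lp 𝕜 2 μ) = ∑ k, a k • G k := by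
      simp [hy, GY]
    have h2 : ∀ᵐ x ∂μ, ∀ k, (a k • G k : Lp 𝕜 2 μ) x = a k * g k x := by
      rw [ae_all_iff]
      intro k
      filter_upwards [Lp.coeFn_smul (a k) (G k), (hg k).coeFn_toLp] with x hx hx'
      rw [hx, Pi.smul_apply, hx', smul_eq_mul]
    have h3 := Lp.coeFn_finsetSum Finset.univ (fun k => a k • G k)
    filter_upwards [h2, h3] with x h2 h3
    rw [h1, h3, Finset.sum_apply]
    exact Finset.sum_congr rfl fun k _ => (h2 k).symm
  rw [eLpNorm_congr_ae hcoe, ← Lp.enorm_def, ← ofReal_norm]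
  exact ENNReal.ofReal_le_ofReal hnorm'

/-- Every space spanned by `n` continuous functions admits `6 n ^ s` points at which the maximum of
the modulus controls the `L_{2s}` norm, up to an absolute constant. -/
theorem exists_points_eLpNorm_two_mul_le {𝕜 Ω : Type*} [RCLike 𝕜] [TopologicalSpace Ω]
    [CompactSpace Ω] [SecondCountableTopology Ω] [MeasurableSpace Ω] [BorelSpace Ω] {μ : Measure Ω}
    [IsProbabilityMeasure μ] {n s : ℕ} (hn : 0 < n) (hs : 0 < s) (u : Fin n → C(Ω, 𝕜)) :
    ∃ ξ : Fin (6 * n ^ s) → Ω, ∀ (c : Fin n → 𝕜) (t : ℝ), 0 ≤ t →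
      (∀ j, ‖(∑ i, c i • u i) (ξ j)‖ ≤ t) →
        eLpNorm (∑ i, c i • u i : C(Ω, 𝕜)) ((2 * s : ℕ) : ℝ≥0∞) μ ≤ ENNReal.ofReal (3 * t) := by
  have hg : ∀ α : Fin s → Fin n, MemLp (∏ k, u (α k) : C(Ω, 𝕜)) 2 μ := fun α =>
    MemLp.of_bound (ContinuousMap.continuous _).aestronglyMeasurable
      ‖(∏ k, u (α k) : C(Ω, 𝕜))‖ (Filter.Eventually.of_forall (ContinuousMap.norm_coe_le_norm _))
  obtain ⟨ξ, hξ⟩ := exists_points_eLpNorm_two_le hg (pow_pos hn s) (by simp)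
  refine ⟨ξ, fun c t ht hle => ?_⟩
  have hpow : ∀ x, ∑ α : Fin s → Fin n, (∏ k, c (α k)) * (∏ k, u (α k) : C(Ω, 𝕜)) x =
      ((∑ i, c i • u i : C(Ω, 𝕜)) x) ^ s := by
    intro x
    simp only [ContinuousMap.coe_sum, ContinuousMap.coe_prod, Finset.sum_apply, Finset.prod_apply,
      ContinuousMap.coe_smul, Pi.smul_apply, smul_eq_mul, Fintype.sum_pow, Finset.prod_mul_distrib]
  have h := hξ (fun α => ∏ k, c (α k)) (t ^ s) (pow_nonneg ht s) (fun j => by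
    rw [hpow, norm_pow]
    exact pow_le_pow_left₀ (norm_nonneg _) (hle j) s)
  simp only [hpow] at h
  have hs' : (0 : ℝ) < s := Nat.cast_pos.2 hs
  rw [← eLpNorm_norm] at h
  simp only [norm_pow, ← Real.rpow_natCast] at h
  rw [eLpNorm_norm_rpow _ hs'] at h
  have hexp : ((2 * s : ℕ) : ℝ≥0∞) = 2 * ENNReal.ofReal (s : ℝ) := by
    rw [ENNReal.ofReal_natCast]; push_cast; rfl
  rw [hexp, ← ENNReal.rpow_le_rpow_iff hs', ENNReal.ofReal_rpow_of_nonneg (by positivity) hs'.le]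
  refine h.trans (ENNReal.ofReal_le_ofReal ?_)
  rw [Real.rpow_natCast, Real.rpow_natCast, mul_pow]
  -- This keeps the constant independent of `s`.
  have : (3 : ℝ) ≤ 3 ^ s := le_self_pow₀ (by norm_num) hs.ne'
  gcongr

/-! ### Nonlinear recovery -/

/-- Recovery by an almost best approximation at points discretizing the norm of the span of `u`. -/
theorem samplingRecovery_le_of_dist_lt {𝕜 Ω : Type*} [RCLike 𝕜] [TopologicalSpace Ω]
    [CompactSpace Ω] [SecondCountableTopology Ω] [MeasurableSpace Ω] [BorelSpace Ω] {μ : Measure Ω}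
    [IsProbabilityMeasure μ] {n s : ℕ} (hn : 0 < n) (hs : 0 < s) (F : Set C(Ω, 𝕜))
    (u : Fin n → C(Ω, 𝕜)) {τ : ℝ} (hτ : 0 ≤ τ)
    (hF : ∀ f ∈ F, ∃ c : Fin n → 𝕜, ‖f - ∑ i, c i • u i‖ ≤ τ) :
    samplingRecovery (6 * n ^ s) F ((2 * s : ℕ) : ℝ≥0∞) μ ≤ ENNReal.ofReal (7 * τ) := by
  classical
  obtain ⟨ξ, hξ⟩ := exists_points_eLpNorm_two_mul_le (μ := μ) hn hs u
  have hmem : ∀ f : C(Ω, 𝕜), MemLp f ((2 * s : ℕ) : ℝ≥0∞) μ := fun f =>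
    MemLp.of_bound f.continuous.aestronglyMeasurable ‖f‖
      (Filter.Eventually.of_forall f.norm_coe_le_norm)
  set G : Fin n → Lp 𝕜 ((2 * s : ℕ) : ℝ≥0∞) μ := fun i => (hmem (u i)).toLp
  have hGsum : ∀ c : Fin n → 𝕜, ∑ i, c i • G i = (hmem (∑ i, c i • u i)).toLp := by
    intro c
    ext1
    have h2 : ∀ᵐ x ∂μ, ∀ i, (c i • G i : Lp 𝕜 ((2 * s : ℕ) : ℝ≥0∞) μ) x = c i * u i x := by
      rw [ae_all_iff]
      intro i
      filter_upwards [Lp.coeFn_smul (c i) (G i), (hmem (u i)).coeFn_toLp] with x hx hx'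
      rw [hx, Pi.smul_apply, hx', smul_eq_mul]
    filter_upwards [h2, Lp.coeFn_finsetSum Finset.univ (fun i => c i • G i),
      (hmem (∑ i, c i • u i)).coeFn_toLp] with x h2 h3 h4
    rw [h3, h4, Finset.sum_apply, ContinuousMap.coe_sum, Finset.sum_apply]
    exact Finset.sum_congr rfl fun i _ => h2 i
  set X := Submodule.span 𝕜 (Set.range G)
  have hfin : FiniteDimensional 𝕜 X := FiniteDimensional.span_of_finite 𝕜 (Set.finite_range G)
  have hrank : Module.finrank 𝕜 X ≤ 6 * n ^ s := by
    refine (finrank_range_le_card G).trans ?_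
    rw [Fintype.card_fin]
    exact (Nat.le_self_pow hs.ne' n).trans (Nat.le_mul_of_pos_left _ (by norm_num))
  let good : (Fin (6 * n ^ s) → 𝕜) → (Fin n → 𝕜) → Prop := fun y c =>
    ∀ j, ‖y j - (∑ i, c i • u i : C(Ω, 𝕜)) (ξ j)‖ ≤ τ
  let coeff : (Fin (6 * n ^ s) → 𝕜) → Fin n → 𝕜 := fun y =>
    if h : ∃ c, good y c then h.choose else 0
  let Φ : (Fin (6 * n ^ s) → 𝕜) → X := fun y => ⟨∑ i, coeff y i • G i,
    X.sum_mem fun i _ => X.smul_mem _ (Submodule.subset_span ⟨i, rfl⟩)⟩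
  rw [samplingRecovery]
  refine iInf_le_of_le ξ <| iInf_le_of_le X <| iInf_le_of_le ⟨hfin, hrank⟩ <|
    iInf_le_of_le Φ <| iSup₂_le fun f hf => ?_
  obtain ⟨c, hc⟩ := hF f hf
  set y : Fin (6 * n ^ s) → 𝕜 := fun j => f (ξ j)
  have hcgood : good y c := fun j =>
    ((f - ∑ i, c i • u i).norm_coe_le_norm (ξ j)).trans hc
  have hex : ∃ c, good y c := ⟨c, hcgood⟩
  have hgood : good y (coeff y) := by
    simp only [coeff, dif_pos hex]
    exact hex.choose_spec
  set c' := coeff y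
  have hae : (fun x => f x - (Φ y : Lp 𝕜 ((2 * s : ℕ) : ℝ≥0∞) μ) x) =ᵐ[μ]
      (f - ∑ i, c i • u i : C(Ω, 𝕜)) + (∑ i, (c i - c' i) • u i : C(Ω, 𝕜)) := by
    have : (Φ y : Lp 𝕜 ((2 * s : ℕ) : ℝ≥0∞) μ) = (hmem (∑ i, c' i • u i)).toLp := hGsum c'
    rw [this]
    filter_upwards [(hmem (∑ i, c' i • u i)).coeFn_toLp] with x hx
    rw [hx]
    simp [sub_mul, Finset.sum_sub_distrib]
  rw [eLpNorm_congr_ae hae]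
  have hp : 1 ≤ ((2 * s : ℕ) : ℝ≥0∞) := by exact_mod_cast (by omega : 1 ≤ 2 * s)
  have h1 : eLpNorm (f - ∑ i, c i • u i : C(Ω, 𝕜)) ((2 * s : ℕ) : ℝ≥0∞) μ ≤
      ENNReal.ofReal τ := by
    refine (eLpNorm_le_of_ae_bound (C := τ) (Filter.Eventually.of_forall fun x =>
      ((f - ∑ i, c i • u i).norm_coe_le_norm x).trans hc)).trans ?_
    simp
  have h2 := hξ (fun i => c i - c' i) (2 * τ) (by positivity) fun j => by
    have e : (∑ i, (c i - c' i) • u i : C(Ω, 𝕜)) (ξ j) =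
        (y j - (∑ i, c' i • u i : C(Ω, 𝕜)) (ξ j)) - (y j - (∑ i, c i • u i : C(Ω, 𝕜)) (ξ j)) := by
      simp [sub_mul, Finset.sum_sub_distrib]
    rw [e]
    refine (norm_sub_le _ _).trans ?_
    linarith [hgood j, hcgood j]
  calc _ ≤ _ := eLpNorm_add_le (ContinuousMap.continuous _).aestronglyMeasurable
        (ContinuousMap.continuous _).aestronglyMeasurable hp
    _ ≤ ENNReal.ofReal τ + ENNReal.ofReal (3 * (2 * τ)) := add_le_add h1 h2
    _ = ENNReal.ofReal (7 * τ) := by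
      rw [← ENNReal.ofReal_add hτ (by positivity)]
      congr 1
      ring

theorem mainTheorem10 :
    ∃ (b : ℕ) (B : ℝ≥0), 0 < b ∧ 0 < B ∧
      ∀ (𝕜 : Type) [RCLike 𝕜] (s : ℕ), 1 ≤ s →
      ∀ (d : ℕ) (Ω : Set (EuclideanSpace ℝ (Fin d))) [CompactSpace Ω]
        (μ : Measure Ω) [IsProbabilityMeasure μ]
        (F : Set C(Ω, 𝕜)), IsCompact F →
      ∀ n : ℕ, 1 ≤ n →
        samplingRecovery (b * n ^ s) F ((2 * s : ℕ) : ℝ≥0∞) μ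
          ≤ (B : ℝ≥0∞) * kolmogorovWidth 𝕜 n F := by
  refine ⟨6, 7, by norm_num, by norm_num, ?_⟩
  intro 𝕜 _ s hs d Ω _ μ _ F _ n hn
  have h7 : ((7 : ℝ≥0) : ℝ≥0∞) = ENNReal.ofReal 7 := by simp
  rw [← ENNReal.div_le_iff' (by simp) (by simp)]
  -- The infima need not be attained; an intermediate finite `a'` supplies the slack.
  refine le_of_forall_gt fun a ha => ?_
  obtain ⟨a', ha, ha'⟩ := exists_between ha
  refine lt_of_le_of_lt ?_ ha'
  obtain ⟨u, hu⟩ := iInf_lt_iff.1 ha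
  have htop : a' ≠ ⊤ := ha'.ne_top
  rw [ENNReal.div_le_iff' (by simp) (by simp), h7, ← ENNReal.ofReal_toReal htop,
    ← ENNReal.ofReal_mul (by norm_num)]
  refine samplingRecovery_le_of_dist_lt hn hs F u ENNReal.toReal_nonneg fun f hf => ?_
  have hlt : (⨅ c : Fin n → 𝕜, ‖f - ∑ i, c i • u i‖ₑ) < a' :=
    (le_iSup₂ (f := fun (f : C(Ω, 𝕜)) (_ : f ∈ F) =>
      ⨅ c : Fin n → 𝕜, ‖f - ∑ i, c i • u i‖ₑ) f hf).trans_lt hu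
  obtain ⟨c, hc⟩ := iInf_lt_iff.1 hlt
  refine ⟨c, ?_⟩
  rw [← toReal_enorm]
  exact ENNReal.toReal_mono htop hc.le
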